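/- **Discriminant.** For real $\alpha,\beta$ and $0<\gamma<\pi/2$ let $$P_{\alpha,\beta,\gamma}(\varphi)=\varphi^2+4\varphi\cos\alpha\cos\beta+4\,\frac{(\cos^2\alpha-\cos^2\gamma)(\cos^2\beta-\cos^2\gamma)}{\sin^2\gamma}$$ and let $\Delta_{\alpha,\beta,\gamma}$ be the discriminant of this polynomial in $\varphi$. Let $a,b,c$ be positive integers and $n=abc$. Let $\alpha=\frac{i\pi}{a}$ and $\beta=\frac{j\pi}{b}$ with integers $1\le i\le\frac{a-1}{2}$ and $1\le j\le b-1$. (1) For every $\gamma=\frac{k\pi}{c}$ with $k$ an integer, $1\le k<\frac c2$, either $\Delta_{\alpha,\beta,\gamma}=0$ or $|\Delta_{\alpha,\beta,\gamma}|\ge 2^{-6n}$. (2) Suppose moreover that $a$ and $b$ are coprime and $\beta\ne\frac{\pi}{2}$. Then for every $\gamma=\frac{k\pi}{c}$ with $1\le k<\frac c2$ the polynomial $P_{\alpha,\beta,\gamma}$ has no double root (real or complex). Furthermore there is $\gamma_0=k_0\frac{\pi}{c}$, with $k_0$ an integer that does not depend on $k$, $1\le k_0\le\lceil\frac c2\rceil$,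 and $k_0\le\lfloor\frac c2\rfloor$ whenever $a\le c$ or $b\le c$, such that for every $\gamma=\frac{k\pi}{c}$ with $1\le k<\frac c2$: - if $\gamma<\gamma_0$, then $\Delta_{\alpha,\beta,\gamma}<0$; - if $\gamma\ge\gamma_0$, then $\Delta_{\alpha,\beta,\gamma}\ge 2^{-6n}$. -/

import Mathlib

open Polynomial in
/-- The polynomial `P_{α,β,γ}` in the variable `φ`: it is `φ + 2 cos α cos β` for `γ = π/2`, and
`φ² + 4 cos α cos β φ + 4 (cos² α - cos² γ)(cos² β - cos² γ) / sin² γ` otherwise. -/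
noncomputable def factorPoly (α β γ : ℝ) : ℝ[X] :=
  open Classical in
  if γ = Real.pi / 2 then X + C (2 * Real.cos α * Real.cos β)
  else X ^ 2 + C (4 * Real.cos α * Real.cos β) * X +
    C (4 * ((Real.cos α ^ 2 - Real.cos γ ^ 2) * (Real.cos β ^ 2 - Real.cos γ ^ 2)) /
      Real.sin γ ^ 2)

/-- The discriminant `Δ_{α,β,γ}` of `P_{α,β,γ}`. -/
noncomputable def factorDiscr (α β γ : ℝ) : ℝ := (factorPoly α β γ).discr

/-- A real polynomial has a double root if some complex number is a root of multiplicity at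
least two. -/
def HasDoubleRoot (p : Polynomial ℝ) : Prop :=
  ∃ z : ℂ, 2 ≤ (p.map (algebraMap ℝ ℂ)).rootMultiplicity z


/-!
For `γ ≠ π / 2` one has `Δ = 16 cot² γ (sin² γ - sin² α sin² β)`, so on `(0, π / 2)` the
discriminant changes sign only at `γ = arcsin |sin α sin β|`.

If `x` is a rational multiple of `π` and `u = exp (2 i x)`, then `4 sin² x = (1 - u) (1 - u⁻¹)` is
an algebraic integer whose conjugates lie in `[0, 4]`. Hence `16 (sin² γ - sin² α sin² β)` is an
algebraic integer of degree at most `n` with all conjugates of absolute value at most `16`. When it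
is nonzero, its norm is at least `1` in absolute value, so it is at least `16 ^ (1 - n)` in
absolute value.

If it vanished with, say, `b` odd, then `4 sin² α sin² β` would be an algebraic integer. Since
`b / (2 sin β)` is one too, so is `b² sin² α`, and hence `sin² α`, because `b² ≡ 1 (mod 4)`. But all
conjugates of `sin² α` lie strictly between `0` and `1`, which is impossible for an algebraic
integer.
-/

section RootsOfUnity

variable {K : Type*} [Field K]

/-- The squared distance from `u` to `1` when `u` is a root of unity, written without conjugation
so that it makes sense in any field and commutes with embeddings. -/
def chordSq (u : K) : K := (1 - u) * (1 - u⁻¹)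

theorem map_chordSq {L : Type*} [Field L] (σ : K →+* L) (u : K) :
    σ (chordSq u) = chordSq (σ u) := by
  simp only [chordSq, map_mul, map_sub, map_one, map_inv₀]

theorem chordSq_eq_zero_iff {u : K} : chordSq u = 0 ↔ u = 1 := by
  simp only [chordSq, mul_eq_zero, sub_eq_zero, eq_comm (a := (1 : K)), inv_eq_one, or_self]

theorem chordSq_eq_norm_sq {z : ℂ} (hz : ‖z‖ = 1) : chordSq z = ((‖1 - z‖ ^ 2 : ℝ) : ℂ) := by
  rw [chordSq, Complex.inv_eq_conj hz, Complex.ofReal_pow, ← Complex.mul_conj', map_sub, map_one]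

theorem norm_map_eq_one_of_pow_eq_one {R : Type*} [Semiring R] {u : R} {n : ℕ} (hn : n ≠ 0)
    (hu : u ^ n = 1) (σ : R →+* ℂ) : ‖σ u‖ = 1 :=
  Complex.norm_eq_one_of_pow_eq_one (by rw [← map_pow, hu, map_one]) hn

theorem map_chordSq_eq_norm_sq {u : K} {n : ℕ} (hn : n ≠ 0) (hu : u ^ n = 1) (σ : K →+* ℂ) :
    σ (chordSq u) = ((‖1 - σ u‖ ^ 2 : ℝ) : ℂ) := by
  rw [map_chordSq, chordSq_eq_norm_sq (norm_map_eq_one_of_pow_eq_one hn hu σ)]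

theorem isIntegral_of_pow_eq_one {R : Type*} [CommRing R] {u : R} {n : ℕ} (hn : n ≠ 0)
    (hu : u ^ n = 1) :
    IsIntegral ℤ u :=
  .of_pow (Nat.pos_of_ne_zero hn) (hu ▸ isIntegral_one)

theorem isIntegral_chordSq {u : K} {n : ℕ} (hn : n ≠ 0) (hu : u ^ n = 1) :
    IsIntegral ℤ (chordSq u) :=
  (isIntegral_one.sub (isIntegral_of_pow_eq_one hn hu)).mul
    (isIntegral_one.sub (isIntegral_of_pow_eq_one hn (by rw [inv_pow, hu, inv_one])))

theorem isIntegral_natCast_div_one_sub {v : K} {b : ℕ} (hv : v ^ b = 1) (hv1 : v ≠ 1) :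
    IsIntegral ℤ (b / (1 - v)) := by
  have hgeom : ∑ k ∈ Finset.range b, v ^ k = 0 := by rw [geom_sum_eq hv1, hv, sub_self, zero_div]
  have hsum : (b / (1 - v) : K) = ∑ k ∈ Finset.range b, ∑ l ∈ Finset.range k, v ^ l := by
    rw [div_eq_iff (sub_ne_zero.2 hv1.symm), Finset.sum_mul,
      Finset.sum_congr rfl fun k _ => geom_sum_mul_neg v k, Finset.sum_sub_distrib, hgeom]
    simp
  rw [hsum]
  exact IsIntegral.sum _ fun k hk => IsIntegral.sum _ fun l _ =>
    (isIntegral_of_pow_eq_one (Nat.ne_zero_of_lt (Finset.mem_range.1 hk)) hv).pow l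

theorem exists_intermediateField_forall_pow_eq_one_mem {n : ℕ} (hn : n ≠ 0) :
    ∃ F : IntermediateField ℚ ℂ, FiniteDimensional ℚ F ∧ Module.finrank ℚ F ≤ n ∧
      ∀ z : ℂ, z ^ n = 1 → z ∈ F := by
  have : NeZero n := ⟨hn⟩
  have hζ := Complex.isPrimitiveRoot_exp n hn
  set ζ := Complex.exp (2 * Real.pi * Complex.I / n)
  have hint : IsIntegral ℚ ζ := (isIntegral_of_pow_eq_one hn hζ.pow_eq_one).tower_top
  refine ⟨IntermediateField.adjoin ℚ {ζ}, IntermediateField.adjoin.finiteDimensional hint, ?_,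
    fun z hz => ?_⟩
  · have hdvd : minpoly ℚ ζ ∣ Polynomial.X ^ n - Polynomial.C 1 :=
      minpoly.dvd ℚ ζ (by simp [hζ.pow_eq_one])
    rw [IntermediateField.adjoin.finrank hint,
      ← Polynomial.natDegree_X_pow_sub_C (n := n) (r := (1 : ℚ))]
    exact Polynomial.natDegree_le_of_dvd hdvd
      (Polynomial.X_pow_sub_C_ne_zero (Nat.pos_of_ne_zero hn) 1)
  · obtain ⟨i, -, rfl⟩ := hζ.eq_pow_of_pow_eq_one hz
    exact pow_mem (IntermediateField.mem_adjoin_simple_self ℚ ζ) i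

end RootsOfUnity

section NumberField

open NumberField

variable {K : Type*} [Field K] [NumberField K]

theorem one_le_norm_mul_house_pow {x : K} (hx : IsIntegral ℤ x) (h0 : x ≠ 0) (φ : K →+* ℂ) :
    1 ≤ ‖φ x‖ * house x ^ (Module.finrank ℚ K - 1) := by
  obtain ⟨m, hm⟩ := IsIntegrallyClosed.isIntegral_iff.1 (Algebra.isIntegral_norm ℚ hx)
  have hm0 : m ≠ 0 := by
    rintro rfl
    rw [map_zero] at hm
    exact h0 (Algebra.norm_eq_zero_iff.1 hm.symm)
  calc (1 : ℝ) ≤ |(m : ℝ)| := by exact_mod_cast Int.one_le_abs hm0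
    _ = ‖Algebra.norm ℚ x‖ := by rw [← hm, eq_intCast, Int.norm_cast_rat, Int.norm_eq_abs]
    _ ≤ _ := norm_norm_le_norm_mul_house_pow x φ

/-- By the parallelogram law `‖1 - z‖² + ‖1 + z‖² = 4`, every conjugate of the quarter lies strictly
between `0` and `1`. -/
theorem not_isIntegral_chordSq_div_four {u : K} {n : ℕ} (hn : n ≠ 0) (hu : u ^ n = 1)
    (hu2 : u ^ 2 ≠ 1) : ¬ IsIntegral ℤ (chordSq u / 4) := by
  intro hint
  have hu1 : u ≠ 1 ∧ u ≠ -1 := by rwa [← not_or, ← sq_eq_one_iff]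
  have h0 : chordSq u / 4 ≠ 0 := div_ne_zero (chordSq_eq_zero_iff.not.2 hu1.1) (by norm_num)
  refine (one_le_house_of_isIntegral hint h0).not_gt ?_
  rw [house, pi_norm_lt_iff one_pos]
  intro σ
  have hnorm := norm_map_eq_one_of_pow_eq_one hn hu σ
  have hpar := parallelogram_law_with_norm ℝ 1 (σ u)
  have hpos : 0 < ‖1 + σ u‖ := by
    rw [norm_pos_iff, ← map_one σ, ← map_add, map_ne_zero]
    exact fun h => hu1.2 (eq_neg_of_add_eq_zero_right h)
  rw [norm_one, hnorm] at hpar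
  rw [canonicalEmbedding.apply_at, map_div₀, map_chordSq_eq_norm_sq hn hu, map_ofNat, norm_div,
    Complex.norm_real, Real.norm_of_nonneg (by positivity), Complex.norm_ofNat, div_lt_one four_pos]
  nlinarith

theorem house_four_mul_chordSq_sub_le {u v w : K} {n : ℕ} (hn : n ≠ 0) (hu : u ^ n = 1)
    (hv : v ^ n = 1) (hw : w ^ n = 1) : house (4 * chordSq w - chordSq u * chordSq v) ≤ 16 := by
  rw [house, pi_norm_le_iff_of_nonneg (by norm_num)]
  intro σ
  have hle : ∀ z : K, z ^ n = 1 → ‖1 - σ z‖ ^ 2 ≤ 4 := by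
    intro z hz
    have hnorm := norm_map_eq_one_of_pow_eq_one hn hz σ
    have htri := norm_sub_le 1 (σ z)
    rw [norm_one, hnorm] at htri
    nlinarith [norm_nonneg (1 - σ z)]
  have huv := mul_le_mul (hle u hu) (hle v hv) (sq_nonneg _) (by norm_num)
  rw [canonicalEmbedding.apply_at, map_sub, map_mul, map_mul, map_ofNat,
    map_chordSq_eq_norm_sq hn hu, map_chordSq_eq_norm_sq hn hv,
    map_chordSq_eq_norm_sq hn hw]
  norm_cast
  rw [Real.norm_eq_abs, abs_le]
  constructor <;> nlinarith [hle w hw, sq_nonneg ‖1 - σ w‖,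
    mul_nonneg (sq_nonneg ‖1 - σ u‖) (sq_nonneg ‖1 - σ v‖)]

end NumberField

section SineIntegrality

open Real

theorem sin_natCast_mul_int_mul_pi_div_eq_zero_iff {a : ℕ} (ha : a ≠ 0) (m : ℕ) (i : ℤ) :
    sin (m * (i * π / a)) = 0 ↔ (a : ℤ) ∣ m * i := by
  have ha' : (a : ℝ) ≠ 0 := Nat.cast_ne_zero.2 ha
  rw [sin_eq_zero_iff]
  refine exists_congr fun t => ?_
  rw [← mul_div_assoc, eq_div_iff ha', ← mul_assoc, mul_right_comm, mul_left_inj' pi_ne_zero,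
    eq_comm, mul_comm (t : ℝ)]
  norm_cast

theorem sin_natCast_mul_int_mul_pi_div_eq_zero {a m : ℕ} (ha : a ≠ 0) (ham : a ∣ m) (i : ℤ) :
    sin (m * (i * π / a)) = 0 :=
  (sin_natCast_mul_int_mul_pi_div_eq_zero_iff ha m i).2
    (dvd_mul_of_dvd_left (Int.natCast_dvd_natCast.2 ham) i)

theorem sin_ne_zero_of_sin_two_mul_ne_zero {x : ℝ} (h : sin (2 * x) ≠ 0) : sin x ≠ 0 :=
  fun h0 => h (by rw [sin_two_mul, h0, mul_zero, zero_mul])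

theorem exists_eq_int_mul_pi_div {n : ℕ} (hn : n ≠ 0) {x : ℝ} (hx : sin (n * x) = 0) :
    ∃ m : ℤ, x = m * π / n := by
  obtain ⟨m, hm⟩ := sin_eq_zero_iff.1 hx
  exact ⟨m, by rw [hm, mul_div_cancel_left₀ _ (Nat.cast_ne_zero.2 hn)]⟩

theorem isIntegral_two_mul_sin {n : ℕ} (hn : n ≠ 0) {x : ℝ} (hx : sin (n * x) = 0) :
    IsIntegral ℤ (2 * sin x) := by
  obtain ⟨m, rfl⟩ := exists_eq_int_mul_pi_div hn hx
  have h := isIntegral_two_mul_sin_rat_mul_pi (m / n)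
  push_cast at h
  rwa [div_mul_eq_mul_div] at h

theorem one_sub_exp_two_mul_mul_I (x : ℝ) :
    1 - Complex.exp (2 * x * Complex.I) =
      -Complex.I * Complex.exp (x * Complex.I) * (2 * sin x : ℝ) := by
  have hsq : Complex.exp (2 * x * Complex.I) = Complex.exp (x * Complex.I) ^ 2 := by
    rw [← Complex.exp_nat_mul, mul_assoc, Nat.cast_ofNat]
  push_cast
  rw [hsq, Complex.exp_mul_I]
  linear_combination (-1 : ℂ) * Complex.sin_sq_add_cos_sq x + Complex.sin x ^ 2 * Complex.I_sq

theorem exp_two_mul_mul_I_eq_one_iff {x : ℝ} :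
    Complex.exp (2 * x * Complex.I) = 1 ↔ sin x = 0 := by
  rw [eq_comm, ← sub_eq_zero, one_sub_exp_two_mul_mul_I]
  simp [-Complex.ofReal_sin]

theorem exp_two_mul_mul_I_pow_eq_one_iff {n : ℕ} {x : ℝ} :
    Complex.exp (2 * x * Complex.I) ^ n = 1 ↔ sin (n * x) = 0 := by
  rw [← exp_two_mul_mul_I_eq_one_iff, ← Complex.exp_nat_mul]
  push_cast
  ring_nf

theorem chordSq_exp_two_mul_mul_I (x : ℝ) :
    chordSq (Complex.exp (2 * x * Complex.I)) = ((2 * sin x) ^ 2 : ℝ) := by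
  have hnorm (y : ℝ) : ‖Complex.exp (y * Complex.I)‖ = 1 := Complex.norm_exp_ofReal_mul_I y
  rw [chordSq_eq_norm_sq (by exact_mod_cast hnorm (2 * x)), one_sub_exp_two_mul_mul_I, norm_mul,
    norm_mul, norm_neg, Complex.norm_I, hnorm, one_mul, one_mul, Complex.norm_real, norm_eq_abs,
    sq_abs]

theorem isIntegral_natCast_div_two_mul_sin {b : ℕ} (hb : b ≠ 0) {x : ℝ} (hx : sin (b * x) = 0)
    (h0 : sin x ≠ 0) : IsIntegral ℤ (b / (2 * sin x)) := by
  rw [← isIntegral_algebraMap_iff (B := ℂ) (algebraMap ℝ ℂ).injective]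
  have hpow := exp_two_mul_mul_I_pow_eq_one_iff.2 hx
  have hexp : IsIntegral ℤ (Complex.exp (x * Complex.I)) := by
    refine isIntegral_of_pow_eq_one (n := 2 * b) (by positivity) ?_
    rw [pow_mul, ← hpow, ← Complex.exp_nat_mul, mul_assoc, Nat.cast_ofNat]
  have hsin : ((2 * sin x : ℝ) : ℂ) ≠ 0 := by exact_mod_cast mul_ne_zero two_ne_zero h0
  have hdiv : ((b / (2 * sin x) : ℝ) : ℂ) =
      -Complex.I * Complex.exp (x * Complex.I) * (b / (1 - Complex.exp (2 * x * Complex.I))) := by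
    rw [one_sub_exp_two_mul_mul_I]
    have := Complex.exp_ne_zero (x * Complex.I)
    rw [Complex.ofReal_div]
    field_simp [Complex.I_ne_zero]
    simp
  rw [Complex.coe_algebraMap, hdiv]
  exact (Complex.isIntegral_int_I.neg.mul hexp).mul
    (isIntegral_natCast_div_one_sub hpow (exp_two_mul_mul_I_eq_one_iff.not.2 h0))

theorem not_isIntegral_sin_sq {n : ℕ} (hn : n ≠ 0) {x : ℝ} (hx : sin (n * x) = 0)
    (h2 : sin (2 * x) ≠ 0) : ¬ IsIntegral ℤ (sin x ^ 2) := by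
  intro hint
  obtain ⟨F, hF, -, hmem⟩ := exists_intermediateField_forall_pow_eq_one_mem hn
  have : NumberField F := ⟨⟩
  have hpow := exp_two_mul_mul_I_pow_eq_one_iff.2 hx
  let u : F := ⟨Complex.exp (2 * x * Complex.I), hmem _ hpow⟩
  refine not_isIntegral_chordSq_div_four (u := u) hn (Subtype.ext hpow) (fun h => h2 ?_) ?_
  · exact_mod_cast exp_two_mul_mul_I_pow_eq_one_iff (n := 2).1 (congrArg Subtype.val h)
  · rw [← isIntegral_algebraMap_iff (algebraMap F ℂ).injective, map_div₀, map_chordSq, map_ofNat,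
      show algebraMap F ℂ u = Complex.exp (2 * x * Complex.I) from rfl, chordSq_exp_two_mul_mul_I]
    convert hint.algebraMap (B := ℂ) using 1
    rw [Complex.coe_algebraMap]
    push_cast
    ring

theorem not_isIntegral_four_mul_sin_sq_mul_sin_sq {a b : ℕ} (ha : a ≠ 0) (hb : Odd b) {α β : ℝ}
    (hα : sin (a * α) = 0) (hβ : sin (b * β) = 0) (hα2 : sin (2 * α) ≠ 0) (hβ1 : sin β ≠ 0) :
    ¬ IsIntegral ℤ (4 * (sin α ^ 2 * sin β ^ 2)) := by
  intro hint
  have hdiv := isIntegral_natCast_div_two_mul_sin hb.pos.ne' hβ hβ1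
  obtain ⟨t, ht⟩ : ∃ t : ℕ, b = 2 * t + 1 := hb
  have hprod : IsIntegral ℤ ((b : ℝ) ^ 2 * sin α ^ 2) := by
    have hcancel : 4 * (sin α ^ 2 * sin β ^ 2) * (b / (2 * sin β)) ^ 2 =
        (b : ℝ) ^ 2 * sin α ^ 2 := by
      field_simp
      ring
    exact hcancel ▸ hint.mul (hdiv.pow 2)
  have hnat : IsIntegral ℤ ((t ^ 2 + t : ℕ) : ℝ) := isIntegral_natCast _
  refine not_isIntegral_sin_sq ha hα hα2 ?_
  have hsub : (b : ℝ) ^ 2 * sin α ^ 2 - (t ^ 2 + t : ℕ) * (2 * sin α) ^ 2 = sin α ^ 2 := by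
    rw [ht]
    push_cast
    ring
  exact hsub ▸ hprod.sub (hnat.mul ((isIntegral_two_mul_sin ha hα).pow 2))

theorem sin_sq_mul_sin_sq_ne_sin_sq {a b c : ℕ} (ha : a ≠ 0) (hb : b ≠ 0) (hc : c ≠ 0)
    (hab : Odd a ∨ Odd b) {α β γ : ℝ} (hα : sin (a * α) = 0) (hβ : sin (b * β) = 0)
    (hγ : sin (c * γ) = 0) (hα2 : sin (2 * α) ≠ 0) (hβ2 : sin (2 * β) ≠ 0) :
    sin α ^ 2 * sin β ^ 2 ≠ sin γ ^ 2 := by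
  intro h
  have hint : IsIntegral ℤ (4 * (sin α ^ 2 * sin β ^ 2)) := by
    convert (isIntegral_two_mul_sin hc hγ).pow 2 using 1
    rw [h]
    ring
  rcases hab with hodd | hodd
  · rw [mul_comm (sin α ^ 2)] at hint
    exact not_isIntegral_four_mul_sin_sq_mul_sin_sq hb hodd hβ hα hβ2
      (sin_ne_zero_of_sin_two_mul_ne_zero hα2) hint
  · exact not_isIntegral_four_mul_sin_sq_mul_sin_sq ha hodd hα hβ hα2
      (sin_ne_zero_of_sin_two_mul_ne_zero hβ2) hint

theorem one_le_abs_sin_sq_sub_mul_pow {n : ℕ} (hn : n ≠ 0) {α β γ : ℝ} (hα : sin (n * α) = 0)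
    (hβ : sin (n * β) = 0) (hγ : sin (n * γ) = 0) (h0 : sin α ^ 2 * sin β ^ 2 ≠ sin γ ^ 2) :
    1 ≤ |16 * (sin γ ^ 2 - sin α ^ 2 * sin β ^ 2)| * 16 ^ (n - 1) := by
  obtain ⟨F, hF, hrank, hmem⟩ := exists_intermediateField_forall_pow_eq_one_mem hn
  have : NumberField F := ⟨⟩
  have hpow {x : ℝ} := exp_two_mul_mul_I_pow_eq_one_iff (n := n) (x := x).2
  let e (x : ℝ) (hx : sin (n * x) = 0) : F := ⟨Complex.exp (2 * x * Complex.I), hmem _ (hpow hx)⟩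
  have he (x : ℝ) (hx : sin (n * x) = 0) : e x hx ^ n = 1 := Subtype.ext (hpow hx)
  have hval (x : ℝ) (hx : sin (n * x) = 0) :
      algebraMap F ℂ (chordSq (e x hx)) = ((2 * sin x) ^ 2 : ℝ) :=
    (map_chordSq _ _).trans (chordSq_exp_two_mul_mul_I x)
  set x : F := 4 * chordSq (e γ hγ) - chordSq (e α hα) * chordSq (e β hβ) with hx
  have hxval : algebraMap F ℂ x = (16 * (sin γ ^ 2 - sin α ^ 2 * sin β ^ 2) : ℝ) := by
    rw [hx, map_sub, map_mul, map_mul, map_ofNat, hval γ hγ, hval α hα, hval β hβ]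
    push_cast
    ring
  have hfour : IsIntegral ℤ (4 : F) := mod_cast isIntegral_natCast (R := ℤ) 4
  have hint : IsIntegral ℤ x :=
    (hfour.mul (isIntegral_chordSq hn (he γ hγ))).sub
      ((isIntegral_chordSq hn (he α hα)).mul (isIntegral_chordSq hn (he β hβ)))
  have hx0 : x ≠ 0 := by
    rw [← map_ne_zero (algebraMap F ℂ), hxval]
    exact_mod_cast mul_ne_zero (by norm_num) (sub_ne_zero.2 h0.symm)
  have hhouse : NumberField.house x ≤ 16 :=
    house_four_mul_chordSq_sub_le hn (he α hα) (he β hβ) (he γ hγ)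
  calc (1 : ℝ) ≤ ‖algebraMap F ℂ x‖ * NumberField.house x ^ (Module.finrank ℚ F - 1) :=
        one_le_norm_mul_house_pow hint hx0 _
    _ ≤ ‖algebraMap F ℂ x‖ * 16 ^ (Module.finrank ℚ F - 1) := by
        gcongr
        exact NumberField.house_nonneg x
    _ ≤ ‖algebraMap F ℂ x‖ * 16 ^ (n - 1) := by
        gcongr
        norm_num
    _ = |16 * (sin γ ^ 2 - sin α ^ 2 * sin β ^ 2)| * 16 ^ (n - 1) := by
        rw [hxval, Complex.norm_real, norm_eq_abs]

end SineIntegrality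

section Discriminant

open Real

variable {α β γ : ℝ}

theorem HasDoubleRoot.discr_eq_zero {p : Polynomial ℝ} (h : HasDoubleRoot p) : p.discr = 0 := by
  obtain ⟨z, hz⟩ := h
  have hp : p.map (algebraMap ℝ ℂ) ≠ 0 := by
    intro h0
    rw [h0, Polynomial.rootMultiplicity_zero] at hz
    omega
  obtain ⟨hroot, hroot'⟩ := (Polynomial.one_lt_rootMultiplicity_iff_isRoot hp).1 hz
  have hdeg : 0 < p.degree := by
    rw [← Polynomial.degree_map p (algebraMap ℝ ℂ)]
    exact Polynomial.degree_pos_of_root hp hroot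
  have hcoprime : ¬ IsCoprime p p.derivative := by
    rw [← Polynomial.isCoprime_map (algebraMap ℝ ℂ), ← Polynomial.derivative_map]
    rintro ⟨f, g, hfg⟩
    have heval := congrArg (Polynomial.eval z) hfg
    rw [Polynomial.eval_add, Polynomial.eval_mul, Polynomial.eval_mul, hroot.eq_zero,
      hroot'.eq_zero, mul_zero, mul_zero, add_zero, Polynomial.eval_one] at heval
    exact zero_ne_one heval
  have hp0 : p ≠ 0 := Polynomial.ne_zero_of_degree_gt hdeg
  have hres := Polynomial.resultant_deriv hdeg
  rw [← Polynomial.natDegree_derivative p,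
    Polynomial.resultant_eq_zero_iff.2 ⟨.inl hp0, hcoprime⟩] at hres
  simpa [hp0] using hres.symm

theorem factorDiscr_eq (hγ : γ ≠ π / 2) (hs : sin γ ≠ 0) :
    factorDiscr α β γ = cot γ ^ 2 * (16 * (sin γ ^ 2 - sin α ^ 2 * sin β ^ 2)) := by
  have hdeg : (factorPoly α β γ).degree = 2 := by
    rw [factorPoly, if_neg hγ]
    compute_degree!
  rw [factorDiscr, Polynomial.discr_of_degree_eq_two hdeg, factorPoly, if_neg hγ]
  simp only [map_mul, Polynomial.coeff_add, Polynomial.coeff_X_pow, OfNat.one_ne_ofNat, ↓reduceIte,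
    Polynomial.coeff_mul_X, Polynomial.mul_coeff_zero, Polynomial.coeff_C_zero, zero_add,
    Polynomial.coeff_C_succ, add_zero, OfNat.zero_ne_ofNat, Polynomial.coeff_X_zero, mul_zero,
    Polynomial.coeff_mul_C, zero_mul, mul_one, cot_eq_cos_div_sin]
  field_simp
  rw [sin_sq α, sin_sq β, sin_sq γ]
  ring

theorem cot_pos_of_mem_Ioo (hγ : γ ∈ Set.Ioo 0 (π / 2)) : 0 < cot γ := by
  rw [cot_eq_cos_div_sin]
  exact div_pos (cos_pos_of_mem_Ioo ⟨by linarith [hγ.1, pi_pos], hγ.2⟩)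
    (sin_pos_of_pos_of_lt_pi hγ.1 (by linarith [hγ.2, pi_pos]))

theorem factorDiscr_eq_of_mem_Ioo (hγ : γ ∈ Set.Ioo 0 (π / 2)) :
    factorDiscr α β γ = cot γ ^ 2 * (16 * (sin γ ^ 2 - sin α ^ 2 * sin β ^ 2)) :=
  factorDiscr_eq hγ.2.ne (sin_pos_of_pos_of_lt_pi hγ.1 (by linarith [hγ.2, pi_pos])).ne'

theorem factorDiscr_eq_zero_iff (hγ : γ ∈ Set.Ioo 0 (π / 2)) :
    factorDiscr α β γ = 0 ↔ sin α ^ 2 * sin β ^ 2 = sin γ ^ 2 := by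
  rw [factorDiscr_eq_of_mem_Ioo hγ,
    mul_eq_zero_iff_left (pow_ne_zero 2 (cot_pos_of_mem_Ioo hγ).ne'),
    mul_eq_zero_iff_left (by norm_num), sub_eq_zero, eq_comm]

/-- The angle in `[0, π / 2]` at which `γ ↦ Δ_{α,β,γ}` changes sign. -/
noncomputable def criticalAngle (α β : ℝ) : ℝ := arcsin |sin α * sin β|

theorem criticalAngle_pos (hα : sin α ≠ 0) (hβ : sin β ≠ 0) : 0 < criticalAngle α β :=
  arcsin_pos.2 (abs_pos.2 (mul_ne_zero hα hβ))

theorem criticalAngle_le_pi_div_two : criticalAngle α β ≤ π / 2 := arcsin_le_pi_div_two _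

theorem criticalAngle_comm : criticalAngle α β = criticalAngle β α := by
  rw [criticalAngle, criticalAngle, mul_comm]

theorem criticalAngle_le {x : ℝ} (hx : x ∈ Set.Icc 0 (π / 2)) (h : |sin α| ≤ sin x) :
    criticalAngle α β ≤ x := by
  have hmul : |sin α * sin β| ≤ |sin α| := by
    rw [abs_mul]
    exact mul_le_of_le_one_right (abs_nonneg _) (abs_sin_le_one β)
  have hone : |sin α * sin β| ≤ 1 := hmul.trans (abs_sin_le_one α)
  rw [criticalAngle, arcsin_le_iff_le_sin ⟨by linarith [abs_nonneg (sin α * sin β)], hone⟩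
    ⟨by linarith [hx.1, pi_pos], hx.2⟩]
  exact hmul.trans h

theorem factorDiscr_neg_iff (hγ : γ ∈ Set.Ioo 0 (π / 2)) :
    factorDiscr α β γ < 0 ↔ γ < criticalAngle α β := by
  have hsin : 0 ≤ sin γ := (sin_pos_of_pos_of_lt_pi hγ.1 (by linarith [hγ.2, pi_pos])).le
  rw [factorDiscr_eq_of_mem_Ioo hγ, ← neg_pos, ← mul_neg, ← mul_neg, neg_sub,
    mul_pos_iff_of_pos_left (pow_pos (cot_pos_of_mem_Ioo hγ) 2),
    mul_pos_iff_of_pos_left (by norm_num), sub_pos, ← mul_pow, criticalAngle,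
    lt_arcsin_iff_sin_lt' ⟨by linarith [hγ.1, pi_pos], hγ.2⟩, sq_lt_sq, abs_of_nonneg hsin]

theorem natCast_mul_pi_div_mem_Ioo {k c : ℕ} (hk : 1 ≤ k) (hkc : 2 * k < c) :
    k * π / c ∈ Set.Ioo 0 (π / 2) := by
  have hc : (0 : ℝ) < c := by exact_mod_cast (by omega : 0 < c)
  have hk' : (0 : ℝ) < k := by exact_mod_cast hk
  have hkc' : (2 * k : ℝ) < c := by exact_mod_cast hkc
  refine ⟨div_pos (mul_pos hk' pi_pos) hc, ?_⟩
  rw [div_lt_div_iff₀ hc two_pos]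
  nlinarith [pi_pos]

theorem one_le_natCast_mul_cot {k c : ℕ} (hk : 1 ≤ k) (hkc : 2 * k < c) :
    1 ≤ c * cot (k * π / c) := by
  have hmem := natCast_mul_pi_div_mem_Ioo hk hkc
  have hc : (0 : ℝ) < c := by exact_mod_cast (by omega : 0 < c)
  have hsin := sin_pos_of_pos_of_lt_pi hmem.1 (by linarith [hmem.2, pi_pos])
  have hkc' : (2 * k + 1 : ℝ) ≤ c := by exact_mod_cast hkc
  rw [cot_eq_cos_div_sin, ← mul_div_assoc, le_div_iff₀ hsin, one_mul]
  calc sin (k * π / c) ≤ 1 := sin_le_one _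
    _ ≤ c * (1 - 2 / π * (k * π / c)) := by
        have hlin : c * (1 - 2 / π * (k * π / c)) = c - 2 * k := by field_simp
        linarith
    _ ≤ c * cos (k * π / c) := by
        gcongr
        exact one_sub_mul_le_cos hmem.1.le hmem.2.le

theorem two_zpow_le_abs_factorDiscr {n c k : ℕ} (hn : n ≠ 0) (hcn : c ∣ n) (hk : 1 ≤ k)
    (hkc : 2 * k < c) (hα : sin (n * α) = 0) (hβ : sin (n * β) = 0)
    (h0 : factorDiscr α β (k * π / c) ≠ 0) :
    (2 : ℝ) ^ (-(6 * n : ℤ)) ≤ |factorDiscr α β (k * π / c)| := by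
  have hmem := natCast_mul_pi_div_mem_Ioo hk hkc
  set γ := k * π / c
  have hγn : sin (n * γ) = 0 := by
    exact_mod_cast sin_natCast_mul_int_mul_pi_div_eq_zero (by omega : c ≠ 0) hcn k
  have harith := one_le_abs_sin_sq_sub_mul_pow hn hα hβ hγn
    ((factorDiscr_eq_zero_iff hmem).not.1 h0)
  have hcot : 1 ≤ (c * cot γ) ^ 2 := one_le_pow₀ (one_le_natCast_mul_cot hk hkc)
  have hc2 : (c : ℝ) ≤ 2 ^ n := by
    exact_mod_cast (Nat.le_of_dvd (Nat.pos_of_ne_zero hn) hcn).trans Nat.lt_two_pow_self.le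
  rw [zpow_neg, inv_le_iff_one_le_mul₀ (by positivity)]
  calc (1 : ℝ) ≤ (c * cot γ) ^ 2 *
        (|16 * (sin γ ^ 2 - sin α ^ 2 * sin β ^ 2)| * 16 ^ (n - 1)) :=
        one_le_mul_of_one_le_of_one_le hcot harith
    _ = |factorDiscr α β γ| * (c ^ 2 * 16 ^ (n - 1)) := by
        rw [factorDiscr_eq_of_mem_Ioo hmem, abs_mul (cot γ ^ 2), abs_of_nonneg (sq_nonneg (cot γ))]
        ring
    _ ≤ |factorDiscr α β γ| * ((2 ^ n) ^ 2 * 16 ^ n) := by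
        gcongr
        · norm_num
        · omega
    _ = |factorDiscr α β γ| * 2 ^ (6 * n : ℤ) := by
        rw [show (16 : ℝ) = 2 ^ 4 by norm_num, ← pow_mul, ← pow_mul, ← pow_add]
        norm_cast
        ring_nf

theorem factorDiscr_ne_zero {a b c k : ℕ} (ha : a ≠ 0) (hb : b ≠ 0) (hab : Odd a ∨ Odd b)
    (hk : 1 ≤ k) (hkc : 2 * k < c) (hα : sin (a * α) = 0) (hβ : sin (b * β) = 0)
    (hα2 : sin (2 * α) ≠ 0) (hβ2 : sin (2 * β) ≠ 0) : factorDiscr α β (k * π / c) ≠ 0 := by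
  have hc : c ≠ 0 := by omega
  rw [ne_eq, factorDiscr_eq_zero_iff (natCast_mul_pi_div_mem_Ioo hk hkc)]
  exact sin_sq_mul_sin_sq_ne_sin_sq ha hb hc hab hα hβ
    (sin_natCast_mul_int_mul_pi_div_eq_zero hc dvd_rfl k) hα2 hβ2

end Discriminant

section CriticalIndex

open Real

variable {α β : ℝ}

/-- The number `k₀` for which `k₀ π / c` is the first multiple of `π / c` that is at least the
critical angle. -/
noncomputable def criticalIndex (c : ℕ) (α β : ℝ) : ℕ := ⌈c * criticalAngle α β / π⌉₊

theorem criticalIndex_comm {c : ℕ} : criticalIndex c α β = criticalIndex c β α := by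
  rw [criticalIndex, criticalIndex, criticalAngle_comm]

theorem criticalIndex_le_iff {c k : ℕ} (hc : 0 < c) :
    criticalIndex c α β ≤ k ↔ criticalAngle α β ≤ k * π / c := by
  have hc' : (0 : ℝ) < c := by exact_mod_cast hc
  rw [criticalIndex, Nat.ceil_le, div_le_iff₀ pi_pos, le_div_iff₀ hc', mul_comm]

theorem one_le_criticalIndex {c : ℕ} (hc : 0 < c) (hα : sin α ≠ 0) (hβ : sin β ≠ 0) :
    1 ≤ criticalIndex c α β := by
  have hc' : (0 : ℝ) < c := by exact_mod_cast hc
  exact Nat.one_le_ceil_iff.2 (div_pos (mul_pos hc' (criticalAngle_pos hα hβ)) pi_pos)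

theorem criticalIndex_le_succ_div_two {c : ℕ} (hc : 0 < c) :
    criticalIndex c α β ≤ (c + 1) / 2 := by
  rw [criticalIndex_le_iff hc]
  have hc' : (0 : ℝ) < c := by exact_mod_cast hc
  have hhalf : (c : ℝ) ≤ 2 * ((c + 1) / 2 : ℕ) := by
    exact_mod_cast (by omega : c ≤ 2 * ((c + 1) / 2))
  refine criticalAngle_le_pi_div_two.trans ?_
  rw [div_le_div_iff₀ two_pos hc']
  nlinarith [pi_pos]

theorem factorDiscr_neg_iff_lt_criticalIndex_mul {c k : ℕ} (hk : 1 ≤ k) (hkc : 2 * k < c) :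
    factorDiscr α β (k * π / c) < 0 ↔ k * π / c < criticalIndex c α β * (π / c) := by
  have hc : (0 : ℝ) < c := by exact_mod_cast (by omega : 0 < c)
  rw [factorDiscr_neg_iff (natCast_mul_pi_div_mem_Ioo hk hkc), ← not_le,
    ← criticalIndex_le_iff (by omega), not_le, mul_div_assoc,
    mul_lt_mul_iff_of_pos_right (by positivity), Nat.cast_lt]

theorem exists_abs_sin_int_mul_pi_div_eq {a : ℕ} (ha : 0 < a) {i : ℤ} (hi : ¬ (a : ℤ) ∣ 2 * i) :
    ∃ m : ℕ, 2 * m < a ∧ |sin (i * π / a)| = sin (m * π / a) := by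
  have ha' : (0 : ℝ) < a := by exact_mod_cast ha
  have hdiv := Int.bmod_add_bdiv i a
  have hlower := Int.le_bmod (x := i) ha
  have hupper := Int.bmod_le (x := i) ha
  generalize Int.bmod i a = r, Int.bdiv i a = q at *
  have hr : 2 * r.natAbs < a := by
    refine lt_of_le_of_ne (by omega) fun h => hi ?_
    have hra : (a : ℤ) = -(2 * r) := by omega
    exact ⟨2 * q - 1, by linear_combination (-2 : ℤ) * hdiv + hra⟩
  refine ⟨r.natAbs, hr, ?_⟩
  have hangle : i * π / a = r * π / a + q * π := by
    rw [div_add' _ _ _ ha'.ne', div_left_inj' ha'.ne', ← hdiv]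
    push_cast
    ring
  have habs : |r * π / a| = r.natAbs * π / a := by
    rw [abs_div, abs_mul, abs_of_pos pi_pos, abs_of_pos ha', Nat.cast_natAbs, Int.cast_abs]
  have hle : |r * π / a| ≤ π := by
    have hr' : (2 * r.natAbs : ℝ) < a := by exact_mod_cast hr
    rw [habs, div_le_iff₀ ha']
    nlinarith [pi_pos]
  rw [hangle, sin_add_int_mul_pi, abs_mul, abs_zpow, abs_neg, abs_one, one_zpow, one_mul,
    abs_sin_eq_sin_abs_of_abs_le_pi hle, habs]

theorem criticalIndex_int_mul_pi_div_le_div_two {a c : ℕ} (ha : 0 < a) (hac : a ≤ c) {i : ℤ}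
    (hi : ¬ (a : ℤ) ∣ 2 * i) : criticalIndex c (i * π / a) β ≤ c / 2 := by
  obtain ⟨m, hm, hsin⟩ := exists_abs_sin_int_mul_pi_div_eq ha hi
  have ha' : (0 : ℝ) < a := by exact_mod_cast ha
  have hc' : (0 : ℝ) < c := by exact_mod_cast ha.trans_le hac
  have hhalf : (2 * (c / 2 : ℕ) : ℝ) ≤ c := by exact_mod_cast Nat.mul_div_le c 2
  have hmem : ((c / 2 : ℕ) * π / c : ℝ) ∈ Set.Icc 0 (π / 2) := by
    refine ⟨by positivity, ?_⟩
    rw [div_le_div_iff₀ hc' two_pos]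
    nlinarith [pi_pos]
  have hmc : m * c ≤ c / 2 * a := by
    have hc2 : c ≤ 2 * (c / 2) + 1 := by omega
    nlinarith
  have hle : m * π / a ≤ (c / 2 : ℕ) * π / c := by
    have hmc' : (m * c : ℝ) ≤ (c / 2 : ℕ) * a := by exact_mod_cast hmc
    rw [div_le_div_iff₀ ha' hc']
    nlinarith [pi_pos]
  rw [criticalIndex_le_iff (ha.trans_le hac)]
  refine criticalAngle_le hmem (hsin.trans_le (sin_le_sin_of_le_of_le_pi_div_two ?_ hmem.2 hle))
  have : 0 ≤ m * π / a := by positivity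
  linarith [pi_pos]

end CriticalIndex

open Real in
theorem mainTheorem10_general {a b c : ℕ} (ha : 0 < a) (hb : 0 < b) (hc : 0 < c) {i j : ℤ}
    {α β : ℝ} (hα : α = i * π / a) (hβ : β = j * π / b) :
    (∀ k : ℕ, 1 ≤ k → 2 * k < c →
      factorDiscr α β (k * π / c) = 0 ∨
        (2 : ℝ) ^ (-(6 * (a * b * c : ℕ) : ℤ)) ≤ |factorDiscr α β (k * π / c)|) ∧
    (Odd a ∨ Odd b → ¬ (a : ℤ) ∣ 2 * i → ¬ (b : ℤ) ∣ 2 * j →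
      (∀ k : ℕ, 1 ≤ k → 2 * k < c → ¬ HasDoubleRoot (factorPoly α β (k * π / c))) ∧
      ∃ (k₀ : ℕ) (γ₀ : ℝ), γ₀ = k₀ * (π / c) ∧
        1 ≤ k₀ ∧ k₀ ≤ (c + 1) / 2 ∧ (a ≤ c ∨ b ≤ c → k₀ ≤ c / 2) ∧
        ∀ (k : ℕ) (γ : ℝ), 1 ≤ k → 2 * k < c → γ = k * π / c →
          (γ < γ₀ → factorDiscr α β γ < 0) ∧
          (γ₀ ≤ γ → (2 : ℝ) ^ (-(6 * (a * b * c : ℕ) : ℤ)) ≤ factorDiscr α β γ)) := by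
  have hbound {k : ℕ} (hk : 1 ≤ k) (hkc : 2 * k < c) (h0 : factorDiscr α β (k * π / c) ≠ 0) :
      (2 : ℝ) ^ (-(6 * (a * b * c : ℕ) : ℤ)) ≤ |factorDiscr α β (k * π / c)| :=
    two_zpow_le_abs_factorDiscr (by positivity) (dvd_mul_left c _) hk hkc
      (hα ▸ sin_natCast_mul_int_mul_pi_div_eq_zero ha.ne' ⟨b * c, mul_assoc a b c⟩ i)
      (hβ ▸ sin_natCast_mul_int_mul_pi_div_eq_zero hb.ne' ⟨a * c, by ring⟩ j) h0
  refine ⟨fun k hk hkc => or_iff_not_imp_left.2 (hbound hk hkc), fun hab hi hj => ?_⟩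
  have hα2 : sin (2 * α) ≠ 0 := by
    rw [hα]
    exact_mod_cast (sin_natCast_mul_int_mul_pi_div_eq_zero_iff ha.ne' 2 i).not.2 hi
  have hβ2 : sin (2 * β) ≠ 0 := by
    rw [hβ]
    exact_mod_cast (sin_natCast_mul_int_mul_pi_div_eq_zero_iff hb.ne' 2 j).not.2 hj
  have hne {k : ℕ} (hk : 1 ≤ k) (hkc : 2 * k < c) : factorDiscr α β (k * π / c) ≠ 0 :=
    factorDiscr_ne_zero ha.ne' hb.ne' hab hk hkc
      (hα ▸ sin_natCast_mul_int_mul_pi_div_eq_zero ha.ne' dvd_rfl i)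
      (hβ ▸ sin_natCast_mul_int_mul_pi_div_eq_zero hb.ne' dvd_rfl j) hα2 hβ2
  refine ⟨fun k hk hkc h => hne hk hkc h.discr_eq_zero, criticalIndex c α β, _, rfl,
    one_le_criticalIndex hc (sin_ne_zero_of_sin_two_mul_ne_zero hα2)
      (sin_ne_zero_of_sin_two_mul_ne_zero hβ2),
    criticalIndex_le_succ_div_two hc, ?_, ?_⟩
  · rintro (hac | hbc)
    · exact hα ▸ criticalIndex_int_mul_pi_div_le_div_two ha hac hi
    · exact criticalIndex_comm.trans_le
        (hβ ▸ criticalIndex_int_mul_pi_div_le_div_two hb hbc hj)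
  · rintro k _ hk hkc rfl
    have hneg := factorDiscr_neg_iff_lt_criticalIndex_mul (α := α) (β := β) hk hkc
    refine ⟨hneg.2, fun hle => ?_⟩
    rw [← abs_of_nonneg (not_lt.1 (hneg.not.2 hle.not_gt))]
    exact hbound hk hkc (hne hk hkc)

theorem not_natCast_dvd_two_mul_of_ne_pi_div_two {b j : ℕ} (hj : 0 < j) (hjb : j < b)
    (hne : j * Real.pi / b ≠ Real.pi / 2) : ¬ (b : ℤ) ∣ 2 * (j : ℤ) := by
  rintro ⟨t, ht⟩
  have ht1 : t = 1 := by
    have hb : (0 : ℤ) < b := by omega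
    have hpos : 0 < t := pos_of_mul_pos_right (by omega : 0 < (b : ℤ) * t) hb.le
    have hlt : t < 2 := lt_of_mul_lt_mul_left (by omega : (b : ℤ) * t < b * 2) hb.le
    omega
  have hb : (b : ℝ) = 2 * j := by
    rw [ht1, mul_one] at ht
    exact_mod_cast ht.symm
  have hj' : (j : ℝ) ≠ 0 := by exact_mod_cast hj.ne'
  exact hne (by rw [hb]; field_simp)

theorem odd_or_odd_of_coprime {a b : ℕ} (h : Nat.Coprime a b) : Odd a ∨ Odd b := by
  by_contra! heven
  simp only [Nat.not_odd_iff_even] at heven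
  exact Nat.not_coprime_of_dvd_of_dvd one_lt_two heven.1.two_dvd heven.2.two_dvd h

theorem mainTheorem10 (a b c i j : ℕ) (hc : 0 < c)
    (hi : 1 ≤ i) (hia : 2 * i + 1 ≤ a) (hj : 1 ≤ j) (hjb : j + 1 ≤ b)
    (α β : ℝ) (hα : α = i * Real.pi / a) (hβ : β = j * Real.pi / b) :
    (∀ k : ℕ, 1 ≤ k → 2 * k < c →
      factorDiscr α β (k * Real.pi / c) = 0 ∨
        (2 : ℝ) ^ (-(6 * (a * b * c : ℕ) : ℤ)) ≤ |factorDiscr α β (k * Real.pi / c)|) ∧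
    (Nat.Coprime a b → β ≠ Real.pi / 2 →
      (∀ k : ℕ, 1 ≤ k → 2 * k < c → ¬ HasDoubleRoot (factorPoly α β (k * Real.pi / c))) ∧
      ∃ (k₀ : ℕ) (γ₀ : ℝ), γ₀ = k₀ * (Real.pi / c) ∧
        1 ≤ k₀ ∧ k₀ ≤ (c + 1) / 2 ∧ (a ≤ c ∨ b ≤ c → k₀ ≤ c / 2) ∧
        ∀ (k : ℕ) (γ : ℝ), 1 ≤ k → 2 * k < c → γ = k * Real.pi / c →
          (γ < γ₀ → factorDiscr α β γ < 0) ∧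
          (γ₀ ≤ γ → (2 : ℝ) ^ (-(6 * (a * b * c : ℕ) : ℤ)) ≤ factorDiscr α β γ)) := by
  have hi' : ¬ (a : ℤ) ∣ 2 * (i : ℤ) := mod_cast Nat.not_dvd_of_pos_of_lt (by omega) hia
  have hj' (hβ2 : β ≠ Real.pi / 2) : ¬ (b : ℤ) ∣ 2 * (j : ℤ) :=
    not_natCast_dvd_two_mul_of_ne_pi_div_two (by omega) (by omega) (hβ ▸ hβ2)
  have hmain := mainTheorem10_general (by omega) (by omega) hc (mod_cast hα) (mod_cast hβ)
  exact ⟨hmain.1, fun hab hβ2 => hmain.2 (odd_or_odd_of_coprime hab) hi' (hj' hβ2)⟩
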